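/- A set $X\subseteq\mathbf{R}$ has \emph{strong measure zero} if for every sequence $(\varepsilon_n)_{n\in\mathbf{N}}$ of positive real numbers there is a cover $\{U_n:n\in\mathbf{N}\}$ of $X$ by relatively open subsets of $X$ such that $\operatorname{diam}U_n\leq\varepsilon_n$ for every $n\in\mathbf{N}$. A set $X\subseteq\mathbf{R}$ is \emph{meager-additive} if $X+M=\{x+m:x\in X,\ m\in M\}$ is meager in $\mathbf{R}$ for every meager set $M\subseteq\mathbf{R}$. The following are equivalent (in ZFC): 1. Every strong measure zero set of reals is countable. 2. Every meager-additive set of reals is countable. -/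

import Mathlib

open scoped Pointwise

/-- A metric space `X` has strong measure zero if for every sequence `ε` of positive real numbers
there is an open cover `U 0, U 1, …` of `X` such that the diameter of `U n` is at most `ε n`
for every `n`. The diameter is taken in `[0, ∞]`, so that unbounded sets have diameter `∞`. -/
def IsStrongMeasureZeroSpace (X : Type*) [MetricSpace X] : Prop :=
  ∀ ε : ℕ → ℝ, (∀ n, 0 < ε n) →
    ∃ U : ℕ → Set X, (∀ n, IsOpen (U n)) ∧ (⋃ n, U n) = Set.univ ∧
      ∀ n, Metric.ediam (U n) ≤ ENNReal.ofReal (ε n)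

/-- A subset of a metric space is a strong measure zero set if it is a strong measure zero space
with respect to the restricted metric. -/
def IsStrongMeasureZeroSet {Y : Type*} [MetricSpace Y] (X : Set Y) : Prop :=
  IsStrongMeasureZeroSpace X

/-- A subset `X` of a topological additive group is meager-additive if `X + M` is meager for every
meager set `M`. -/
def IsMeagerAdditive {G : Type*} [AddGroup G] [TopologicalSpace G] [IsTopologicalAddGroup G]
    (X : Set G) : Prop :=
  ∀ M : Set G, IsMeagre M → IsMeagre (X + M)

open Set Filter Topology Metric

/-! Meager-additive sets have strong measure zero by a Baire category argument. Conversely, from an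
uncountable strong measure zero set one gets an uncountable meager-additive set by cases on whether
the bounding number exceeds ℵ₁; both cases verify `isMeagerAdditive_of_forall_exists_capture`. If
every ℵ₁ functions are eventually bounded, the places where ℵ₁ points of the given set are captured
have a common bound. Otherwise an unbounded family of size ℵ₁ guides a tower of sparse subsets of ℕ,
coded as reals. One level with long gaps captures all later levels by finitely many initial
patterns, and the earlier levels are only countably many. -/

/-! ### Meager sets and the capture criterion -/

theorem IsCompact.exists_uniform_ball_disjoint {F : Set ℝ} (hF : IsCompact F)
    (hint : interior F = ∅) {l : ℝ} (hl : 0 < l) :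
    ∃ δ > 0, ∀ a, ∃ b, ball b δ ⊆ ball a l ∧ Disjoint (ball b δ) F := by
  have key : ∃ δ > 0, ∀ a ∈ cthickening l F, ∃ b, ball b δ ⊆ ball a l ∧ Disjoint (ball b δ) F := by
    refine hF.cthickening.induction_on
      (p := fun S => ∃ δ > 0, ∀ a ∈ S, ∃ b, ball b δ ⊆ ball a l ∧ Disjoint (ball b δ) F)
      ⟨1, one_pos, by simp⟩ ?_ ?_ ?_
    · rintro s t hst ⟨δ, h0, h⟩
      exact ⟨δ, h0, fun a ha => h a (hst ha)⟩
    · rintro s t ⟨δ, h0, h⟩ ⟨δ', h0', h'⟩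
      refine ⟨min δ δ', lt_min h0 h0', ?_⟩
      rintro a (ha | ha)
      · obtain ⟨b, h1, h2⟩ := h a ha
        have := ball_subset_ball (x := b) (min_le_left δ δ')
        exact ⟨b, this.trans h1, h2.mono_left this⟩
      · obtain ⟨b, h1, h2⟩ := h' a ha
        have := ball_subset_ball (x := b) (min_le_right δ δ')
        exact ⟨b, this.trans h1, h2.mono_left this⟩
    · intro a _
      obtain ⟨b, hbF, hb⟩ := (interior_eq_empty_iff_dense_compl.1 hint).exists_dist_lt a
        (half_pos hl)
      obtain ⟨δ, h0, hδ⟩ := isOpen_iff.1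
        (hF.isClosed.isOpen_compl.inter (isOpen_ball (x := a) (ε := l / 2))) b
        ⟨hbF, by rwa [mem_ball, dist_comm]⟩
      refine ⟨ball a (l / 2), mem_nhdsWithin_of_mem_nhds (ball_mem_nhds a (half_pos hl)), δ, h0,
        fun a' ha' => ⟨b, fun z hz => ?_, ?_⟩⟩
      · have h1 := (hδ hz).2
        rw [mem_ball] at h1 ha' ⊢
        rw [dist_comm] at ha'
        linarith [dist_triangle z a a']
      · exact disjoint_left.2 fun z hz => (hδ hz).1
  obtain ⟨δ, h0, h⟩ := key
  refine ⟨min δ l, lt_min h0 hl, fun a => ?_⟩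
  by_cases ha : a ∈ cthickening l F
  · obtain ⟨b, h1, h2⟩ := h a ha
    have := ball_subset_ball (x := b) (min_le_left δ l)
    exact ⟨b, this.trans h1, h2.mono_left this⟩
  · refine ⟨a, ball_subset_ball (min_le_right _ _), disjoint_left.2 fun z hz hzF => ha ?_⟩
    refine mem_cthickening_of_dist_le a z l F hzF ?_
    rw [mem_ball, dist_comm] at hz
    exact (hz.trans_le (min_le_right _ _)).le

/-- Halving the radius leaves room for `x` to vary around `u`, so a single ball avoids all the
translates `x + F` at once. -/
theorem IsCompact.exists_uniform_ball_avoiding_translates {F : Set ℝ} (hF : IsCompact F)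
    (hint : interior F = ∅) {l : ℝ} (hl : 0 < l) :
    ∃ δ > 0, δ ≤ l / 2 ∧ ∀ a u, ∃ b, ball b δ ⊆ ball a l ∧
      ∀ z ∈ ball b δ, ∀ x, |x - u| < δ → z - x ∉ F := by
  obtain ⟨δ, h0, h⟩ := hF.exists_uniform_ball_disjoint hint hl
  refine ⟨min (δ / 2) (l / 2), by positivity, min_le_right _ _, fun a u => ?_⟩
  obtain ⟨b, h1, h2⟩ := h (a - u)
  have hm := min_le_left (δ / 2) (l / 2)
  refine ⟨b + u, fun z hz => ?_, fun z hz x hx hzx => ?_⟩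
  · have : z - u ∈ ball b δ := by
      rw [mem_ball, Real.dist_eq] at hz ⊢
      rw [show z - u - b = z - (b + u) by ring]
      linarith
    have := h1 this
    rwa [mem_ball, Real.dist_eq, show z - u - (a - u) = z - a by ring] at this
  · refine disjoint_left.1 h2 ?_ hzx
    rw [mem_ball, Real.dist_eq] at hz ⊢
    rw [abs_lt] at *
    constructor <;> linarith

theorem IsMeagre.exists_monotone_isCompact {M : Set ℝ} (hM : IsMeagre M) :
    ∃ F : ℕ → Set ℝ, Monotone F ∧ (∀ n, IsCompact (F n)) ∧ (∀ n, interior (F n) = ∅) ∧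
      M ⊆ ⋃ n, F n := by
  obtain ⟨S, hS, hc, hMS⟩ := isMeagre_iff_countable_union_isNowhereDense.1 hM
  obtain ⟨t, ht⟩ := (hc.insert ∅).exists_eq_range (insert_nonempty _ _)
  have htn : ∀ n, IsNowhereDense (t n) := fun n => by
    have : t n ∈ insert ∅ S := ht ▸ mem_range_self n
    rcases this with h | h
    · rw [h]; exact isNowhereDense_empty
    · exact hS _ h
  have hacc : ∀ n, IsClosed (accumulate (fun n => closure (t n)) n) ∧
      interior (accumulate (fun n => closure (t n)) n) = ∅ := fun n => by
    induction n with
    | zero =>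
      rw [show accumulate (fun n => closure (t n)) 0 = closure (t 0) by simp [accumulate_def]]
      exact ⟨isClosed_closure, htn 0⟩
    | succ n ih =>
      rw [accumulate_succ]
      refine ⟨ih.1.union isClosed_closure, ?_⟩
      rw [interior_union_isClosed_of_interior_empty ih.1 (htn (n + 1)), ih.2]
  refine ⟨fun n => accumulate (fun n => closure (t n)) n ∩ closedBall 0 n, fun m n hmn => ?_,
    fun n => (isCompact_closedBall 0 _).inter_left (hacc n).1, fun n => ?_, fun x hx => ?_⟩
  · exact inter_subset_inter (monotone_accumulate hmn)
      (closedBall_subset_closedBall (by exact_mod_cast hmn))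
  · exact subset_eq_empty (interior_mono inter_subset_left) (hacc n).2
  · obtain ⟨s, hs, hxs⟩ := hMS hx
    obtain ⟨i, rfl⟩ : s ∈ range t := ht ▸ mem_insert_of_mem _ hs
    obtain ⟨j, hj⟩ := exists_nat_ge |x|
    refine mem_iUnion.2 ⟨max i j, mem_accumulate.2 ⟨i, le_max_left _ _, subset_closure hxs⟩, ?_⟩
    rw [mem_closedBall, Real.dist_eq, sub_zero]
    exact hj.trans (by exact_mod_cast le_max_right i j)

/-- A combinatorial criterion for meager-additivity: for every prescribed sequence of radii, `X` is
captured by a sequence of finite systems of intervals. -/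
theorem isMeagerAdditive_of_forall_exists_capture {X : Set ℝ}
    (hX : ∀ ε : ℕ → ℝ, (∀ n, 0 < ε n) → ∃ (u : ℕ → ℕ → ℝ) (q : ℕ → ℕ),
      ∀ x ∈ X, ∀ᶠ n in atTop, ∃ k, n ≤ k ∧ k < q n ∧ |x - u n k| < ε k) :
    IsMeagerAdditive X := by
  intro M hM
  obtain ⟨F, hmono, hcomp, hint, hMF⟩ := hM.exists_monotone_isCompact
  choose! δ hδ0 hδl hδ using fun (n : ℕ) (l : ℝ) (hl : 0 < l) =>
    (hcomp n).exists_uniform_ball_avoiding_translates (hint n) hl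
  -- Inside any ball of radius `l k` some ball of radius `l (k + 1)` avoids `x + F k` for all `x`
  -- close to a given centre.
  let l : ℕ → ℝ := fun n => Nat.rec 1 δ n
  have hl0 : ∀ n, 0 < l n := fun n => by
    induction n with
    | zero => exact one_pos
    | succ n ih => exact hδ0 n _ ih
  have hlhalf : ∀ n, l n ≤ (1 / 2) ^ n := fun n => by
    induction n with
    | zero => simp [l]
    | succ n ih =>
      have : l (n + 1) ≤ l n / 2 := hδl n _ (hl0 n)
      rw [pow_succ]; linarith
  obtain ⟨u, q, huq⟩ := hX (fun k => l (k + 1)) fun k => hl0 (k + 1)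
  have nested : ∀ (v : ℕ → ℝ) (p r : ℕ), p ≤ r → ∀ a, ∃ b, ball b (l r) ⊆ ball a (l p) ∧
      ∀ z ∈ ball b (l r), ∀ k, p ≤ k → k < r → ∀ x, |x - v k| < l (k + 1) → z - x ∉ F k := by
    intro v p r hpr a
    induction r, hpr using Nat.le_induction with
    | base => exact ⟨a, Subset.rfl, fun z _ k h1 h2 => by omega⟩
    | succ r hpr ih =>
      obtain ⟨b, hb, hbF⟩ := ih
      obtain ⟨c, hc, hcF⟩ := hδ r _ (hl0 r) b (v r)
      refine ⟨c, hc.trans hb, fun z hz k hk1 hk2 x hx => ?_⟩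
      rcases Nat.lt_succ_iff_lt_or_eq.1 hk2 with h | rfl
      · exact hbF z (hc hz) k hk1 h x hx
      · exact hcF z hz x hx
  -- `V n` meets every ball of radius `l n`, so the points lying in infinitely many `V n` are
  -- comeager; they avoid `X + M`.
  let V : ℕ → Set ℝ := fun n => interior
    {z | ∀ k, n ≤ k → k < q n → ∀ x, |x - u n k| < l (k + 1) → z - x ∉ F k}
  have hdense : ∀ N, Dense (⋃ n ≥ N, V n) := fun N => by
    refine dense_iff.2 fun a ρ hρ => ?_
    obtain ⟨m, hm⟩ := exists_pow_lt_of_lt_one hρ (by norm_num : (1 / 2 : ℝ) < 1)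
    have hlρ : l (max m N) ≤ ρ := (hlhalf _).trans
      ((pow_le_pow_of_le_one (by norm_num) (by norm_num) (le_max_left m N)).trans hm.le)
    obtain ⟨b, hb, hbF⟩ := nested (u (max m N)) (max m N) (max (max m N) (q (max m N)))
      (le_max_left _ _) a
    refine ⟨b, ball_subset_ball hlρ (hb (mem_ball_self (hl0 _))),
      mem_iUnion₂.2 ⟨max m N, le_max_right _ _, ?_⟩⟩
    refine mem_interior.2 ⟨ball b (l (max (max m N) (q (max m N)))), fun z hz k h1 h2 => ?_,
      isOpen_ball, mem_ball_self (hl0 _)⟩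
    exact hbF z hz k h1 (h2.trans_le (le_max_right _ _))
  refine IsMeagre.mono ?_ (isMeagre_iUnion (f := fun N => (⋃ n ≥ N, V n)ᶜ) fun N => ?_)
  · rintro _ ⟨x, hx, y, hy, rfl⟩
    obtain ⟨i, hi⟩ := mem_iUnion.1 (hMF hy)
    obtain ⟨j, hj⟩ := eventually_atTop.1 (huq x hx)
    refine mem_iUnion.2 ⟨max i j, fun hmem => ?_⟩
    obtain ⟨n, hn, hV⟩ := mem_iUnion₂.1 hmem
    obtain ⟨k, h1, h2, h3⟩ := hj n ((le_max_right i j).trans hn)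
    refine interior_subset hV k h1 h2 x h3 ?_
    simpa using hmono (((le_max_left i j).trans hn).trans h1) hi
  · rw [IsMeagre, compl_compl]
    exact residual_of_dense_open (isOpen_biUnion fun n _ => isOpen_interior) (hdense N)

/-! ### Strong measure zero sets -/

theorem IsMeagerAdditive.isStrongMeasureZeroSet {X : Set ℝ} (hX : IsMeagerAdditive X) :
    IsStrongMeasureZeroSet X := by
  intro ε hε
  let G : Set ℝ := ⋃ n, ball (TopologicalSpace.denseSeq ℝ n) (ε n / 2)
  have hGo : IsOpen G := isOpen_iUnion fun n => isOpen_ball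
  have hGd : Dense G := (TopologicalSpace.denseRange_denseSeq ℝ).mono <| by
    rintro _ ⟨n, rfl⟩
    exact mem_iUnion.2 ⟨n, mem_ball_self (half_pos (hε n))⟩
  have hG : IsMeagre Gᶜ := by
    rw [IsMeagre, compl_compl]
    exact residual_of_dense_open hGo hGd
  -- Such a `y` satisfies `y - X ⊆ G`, so the balls forming `G` pull back to the cover.
  obtain ⟨y, hy⟩ : ∃ y, y ∉ X + Gᶜ := by
    by_contra! h
    exact not_isMeagre_of_isOpen isOpen_univ univ_nonempty
      ((eq_univ_of_forall h) ▸ hX _ hG)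
  refine ⟨fun n => (fun x : X => y - x) ⁻¹' ball (TopologicalSpace.denseSeq ℝ n) (ε n / 2),
    fun n => isOpen_ball.preimage (by fun_prop), eq_univ_of_forall fun x => ?_, fun n => ?_⟩
  · have : y - x ∈ G := by
      by_contra h
      exact hy ⟨x, x.2, y - x, h, by simp⟩
    simpa [G] using this
  · refine ediam_le fun a ha b hb => ?_
    rw [edist_dist]
    refine ENNReal.ofReal_le_ofReal ?_
    rw [mem_preimage, mem_ball, Real.dist_eq, abs_lt] at ha hb
    rw [Subtype.dist_eq, Real.dist_eq, abs_le]
    constructor <;> linarith [ha.1, ha.2, hb.1, hb.2]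

theorem IsStrongMeasureZeroSet.exists_frequently_near {X : Set ℝ} (hX : IsStrongMeasureZeroSet X)
    {ε : ℕ → ℝ} (hε : ∀ n, 0 < ε n) :
    ∃ u : ℕ → ℝ, ∀ x ∈ X, ∀ n, ∃ k ≥ n, |x - u k| < ε k := by
  classical
  -- One cover for each `j`, placed at indices `Nat.pair j i ≥ j`, makes every point be hit
  -- infinitely often; halving gives the strict inequality.
  choose U _ hcov hdiam using fun j => hX (fun i => ε (Nat.pair j i) / 2) fun i => half_pos (hε _)
  let c : ℕ → ℕ → ℝ := fun j i => if h : (U j i).Nonempty then h.some else 0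
  refine ⟨fun k => c k.unpair.1 k.unpair.2, fun x hx n => ?_⟩
  obtain ⟨i, hi⟩ := mem_iUnion.1 ((hcov n).symm ▸ mem_univ (⟨x, hx⟩ : X))
  refine ⟨Nat.pair n i, Nat.left_le_pair n i, ?_⟩
  have hne : (U n i).Nonempty := ⟨_, hi⟩
  have h1 := (edist_le_ediam_of_mem hi hne.some_mem).trans (hdiam n i)
  rw [edist_dist, ENNReal.ofReal_le_ofReal_iff (half_pos (hε _)).le, Subtype.dist_eq,
    Real.dist_eq] at h1
  simp only [Nat.unpair_pair, c, dif_pos hne]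
  linarith [hε (Nat.pair n i)]

/-! ### Sparse towers -/

theorem exists_sparse_pseudoIntersection {κ : Type*} [Countable κ] (x : κ → Set ℕ)
    (hx : ∀ t : Set κ, t.Finite → (⋂ i ∈ t, x i).Infinite) (f : ℕ → ℕ) :
    ∃ S : Set ℕ, S.Infinite ∧ (∀ m ∈ S, ∀ n ∈ S, m < n → f m ≤ n) ∧
      ∀ i, ∀ᶠ n in atTop, n ∈ S → n ∈ x i := by
  obtain ⟨e, he⟩ := exists_injective_nat κ
  have hY : ∀ n m : ℕ, ∃ a ∈ ⋂ i ∈ {i | e i ≤ n}, x i, m ≤ a := fun n m => by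
    have hfin : {i | e i ≤ n}.Finite := (finite_Iic n).preimage he.injOn
    obtain ⟨a, ha, hma⟩ := (hx _ hfin).exists_gt m
    exact ⟨a, ha, hma.le⟩
  choose next hnext hle using hY
  let a : ℕ → ℕ := fun n => Nat.rec (next 0 0) (fun n b => next (n + 1) (max (f b) (b + 1))) n
  have ha : ∀ n i, e i ≤ n → a n ∈ x i := fun n i hi => by
    cases n with
    | zero => exact mem_iInter₂.1 (hnext 0 0) i hi
    | succ n => exact mem_iInter₂.1 (hnext (n + 1) _) i hi
  have hstep : ∀ n, max (f (a n)) (a n + 1) ≤ a (n + 1) := fun n => hle (n + 1) _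
  have hmono : StrictMono a := strictMono_nat_of_lt_succ fun n => (le_max_right _ _).trans (hstep n)
  refine ⟨range a, infinite_range_of_injective hmono.injective, ?_, fun i => ?_⟩
  · rintro _ ⟨m, rfl⟩ _ ⟨n, rfl⟩ hmn
    exact ((le_max_left _ _).trans (hstep m)).trans (hmono.monotone (hmono.lt_iff_lt.1 hmn))
  · filter_upwards [eventually_ge_atTop (a (e i))]
    rintro _ hn ⟨m, rfl⟩
    exact ha m i (hmono.le_iff_le.1 hn)

theorem exists_sparse_tower {ι : Type*} [LinearOrder ι] [WellFoundedLT ι]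
    (hι : ∀ i : ι, (Iio i).Countable) (F : ι → ℕ → ℕ) :
    ∃ x : ι → Set ℕ, (∀ i, (x i).Infinite) ∧
      (∀ i, ∀ m ∈ x i, ∀ n ∈ x i, m < n → F i m ≤ n) ∧
      ∀ i j, i < j → ∀ᶠ n in atTop, n ∈ x j → n ∈ x i := by
  -- The intersection hypothesis sits inside the existential so that the choice is total and can
  -- drive well-founded recursion.
  have step : ∀ (j : ι) (y : ∀ i, i < j → Set ℕ), ∃ S : Set ℕ,
      (∀ t : Set (Iio j), t.Finite → (⋂ i ∈ t, y i.1 i.2).Infinite) →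
      S.Infinite ∧ (∀ m ∈ S, ∀ n ∈ S, m < n → F j m ≤ n) ∧
        ∀ i (hi : i < j), ∀ᶠ n in atTop, n ∈ S → n ∈ y i hi := fun j y => by
    by_cases h : ∀ t : Set (Iio j), t.Finite → (⋂ i ∈ t, y i.1 i.2).Infinite
    · have := (hι j).to_subtype
      obtain ⟨S, h1, h2, h3⟩ := exists_sparse_pseudoIntersection
        (fun i : Iio j => y i.1 i.2) h (F j)
      exact ⟨S, fun _ => ⟨h1, h2, fun i hi => h3 ⟨i, hi⟩⟩⟩
    · exact ⟨∅, fun h' => absurd h' h⟩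
  choose S hS using step
  let x : ι → Set ℕ := (wellFounded_lt (α := ι)).fix S
  have hfix : ∀ j, x j = S j fun i _ => x i := fun j => WellFounded.fix_eq _ _ _
  have main : ∀ j, (x j).Infinite ∧ (∀ m ∈ x j, ∀ n ∈ x j, m < n → F j m ≤ n) ∧
      ∀ i, i < j → ∀ᶠ n in atTop, n ∈ x j → n ∈ x i := fun j => by
    induction j using WellFoundedLT.induction with
    | ind j ih =>
      rw [hfix j]
      refine hS j (fun i _ => x i) fun t ht => ?_
      rcases t.eq_empty_or_nonempty with rfl | hne
      · simpa using infinite_univ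
      obtain ⟨m, hm, hmax⟩ := t.exists_max_image id ht hne
      refine Nat.frequently_atTop_iff_infinite.1 ?_
      have h1 : ∀ᶠ n in atTop, ∀ i ∈ t, n ∈ x m → n ∈ x i := (eventually_all_finite ht).2
        fun i hi => by
          rcases (hmax i hi).lt_or_eq with h | h
          · exact (ih m m.2).2.2 i h
          · simp only [id] at h
            simp [h]
      refine ((Nat.frequently_atTop_iff_infinite.2 (ih m m.2).1).and_eventually h1).mono ?_
      exact fun n hn => mem_iInter₂.2 fun i hi => hn.2 i hi hn.1
  exact ⟨x, fun i => (main i).1, fun i => (main i).2.1, fun i j hij => (main j).2.2 i hij⟩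

/-! ### Coding sets of naturals as reals -/

theorem abs_cantorFunction_sub_le {c : ℝ} (h0 : 0 ≤ c) (h1 : c < 1) (q : ℕ) {f g : ℕ → Bool}
    (hfg : ∀ n < q, f n = g n) :
    |Cardinal.cantorFunction c f - Cardinal.cantorFunction c g| ≤
      c ^ q * Cardinal.cantorFunction c fun _ => true := by
  induction q generalizing f g with
  | zero =>
    have hnonneg : ∀ f : ℕ → Bool, 0 ≤ Cardinal.cantorFunction c f := fun f =>
      tsum_nonneg fun n => Cardinal.cantorFunctionAux_nonneg h0
    have hle : ∀ f : ℕ → Bool, Cardinal.cantorFunction c f ≤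
        Cardinal.cantorFunction c fun _ => true := fun f =>
      Cardinal.cantorFunction_le h0 h1 fun _ _ => rfl
    rw [pow_zero, one_mul, abs_le]
    constructor <;> linarith [hnonneg f, hnonneg g, hle f, hle g]
  | succ q ih =>
    rw [Cardinal.cantorFunction_succ f h0 h1, Cardinal.cantorFunction_succ g h0 h1,
      hfg 0 q.succ_pos, add_sub_add_left_eq_sub, ← mul_sub, abs_mul, abs_of_nonneg h0, pow_succ',
      mul_assoc]
    exact mul_le_mul_of_nonneg_left (ih fun n hn => hfg (n + 1) (Nat.succ_lt_succ hn)) h0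

open Classical in
/-- The real number whose ternary digits `0` and `1` are given by the indicator of `s`. -/
noncomputable def ternaryReal (s : Set ℕ) : ℝ :=
  Cardinal.cantorFunction (1 / 3) fun n => decide (n ∈ s)

theorem ternaryReal_injective : Function.Injective ternaryReal := fun s t h => by
  have := Cardinal.cantorFunction_injective (by norm_num) (by norm_num) h
  ext n
  simpa using congrFun this n

/-- With no elements in `[p, q)`, the pattern below `p`, one of `2 ^ p`, already fixes the digits
below `q`. -/
theorem exists_abs_ternaryReal_sub_le {s : Set ℕ} {p q : ℕ} (hs : ∀ m ∈ s, p ≤ m → q ≤ m) :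
    ∃ k < 2 ^ p, |ternaryReal s - Cardinal.cantorFunction (1 / 3) k.testBit| ≤
      (1 / 3) ^ q * Cardinal.cantorFunction (1 / 3) fun _ => true := by
  classical
  refine ⟨Nat.ofBits fun i : Fin p => decide (i.1 ∈ s), Nat.ofBits_lt_two_pow _,
    abs_cantorFunction_sub_le (by norm_num) (by norm_num) q fun n hn => ?_⟩
  rcases lt_or_ge n p with h | h
  · rw [Nat.testBit_ofBits_lt _ _ h]
  · rw [Nat.testBit_ofBits_ge _ _ h, decide_eq_false_iff_not]
    exact fun hns => (hs n hns h).not_gt hn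

/-! ### The unbounded and bounded cases -/

theorem exists_uncountable_isMeagerAdditive_of_unbounded {ι : Type*} [LinearOrder ι]
    [WellFoundedLT ι] (hι : ∀ i : ι, (Iio i).Countable) (F : ι → ℕ → ℕ)
    (hF : ∀ h : ℕ → ℕ, ∃ i, ∃ᶠ n in atTop, h n < F i n) :
    ∃ X : Set ℝ, IsMeagerAdditive X ∧ ¬ X.Countable := by
  obtain ⟨x, hinf, hsparse, htower⟩ := exists_sparse_tower hι fun i => partialSups (F i)
  -- If neither `p` nor `H p` starts a gap, two elements of `x i` lie between `p` and `H (H p)`, and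
  -- sparseness forces `F i p < H (H p)`.
  have gap : ∀ h : ℕ → ℕ, ∃ i, ∀ N, ∃ p ≥ N, ∀ m ∈ x i, p ≤ m → h p ≤ m := fun h => by
    let H : ℕ → ℕ := fun p => max (h p) p
    obtain ⟨i, hi⟩ := hF (fun p => H (H p))
    refine ⟨i, fun N => ?_⟩
    obtain ⟨p, hNp, hp⟩ := frequently_atTop.1 hi N
    by_contra! hcon
    obtain ⟨a, ha, hpa, hap⟩ := hcon p hNp
    obtain ⟨b, hb, hpb, hbp⟩ := hcon (H p) (hNp.trans (le_max_right _ _))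
    have hab : a < b := hap.trans_le ((le_max_left _ _).trans hpb)
    have h1 := hsparse i a ha b hb hab
    have h2 : F i p ≤ partialSups (F i) a := le_partialSups_of_le (F i) hpa
    have h3 : h (H p) ≤ H (H p) := le_max_left _ _
    omega
  refine ⟨range fun i => ternaryReal (x i), ?_, fun hcount => ?_⟩
  · refine isMeagerAdditive_of_forall_exists_capture fun ε hε => ?_
    have hh : ∀ p : ℕ, ∃ q : ℕ, ∀ k ∈ Finset.range (p + 2 ^ p),
        (1 / 3) ^ q * Cardinal.cantorFunction (1 / 3) (fun _ => true) < ε k := fun p => by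
      refine Eventually.exists (f := atTop) ((Finset.eventually_all _).2 fun k _ => ?_)
      refine Tendsto.eventually_lt_const (hε k) ?_
      simpa using (tendsto_pow_atTop_nhds_zero_of_lt_one (r := (1 / 3 : ℝ)) (by norm_num)
        (by norm_num)).mul_const (Cardinal.cantorFunction (1 / 3) (fun _ => true))
    choose h hh using hh
    obtain ⟨i, hi⟩ := gap h
    choose p hp hgap using hi
    obtain ⟨e, he⟩ := countable_iff_exists_subset_range.1 ((hι i).image fun j => ternaryReal (x j))
    -- From index `p n ≥ n` on, all `2 ^ p n` initial patterns are listed, then the first `n` points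
    -- of an enumeration covering the levels below `i`.
    refine ⟨fun n k => if k < p n + 2 ^ p n then Cardinal.cantorFunction (1 / 3)
      (k - p n).testBit else e (k - (p n + 2 ^ p n)), fun n => p n + 2 ^ p n + n, ?_⟩
    rintro _ ⟨j, rfl⟩
    rcases lt_or_ge j i with hji | hij
    · obtain ⟨m, hm⟩ := he (mem_image_of_mem _ hji)
      filter_upwards [eventually_gt_atTop m] with n hn
      refine ⟨p n + 2 ^ p n + m, ?_, by omega, by simpa [hm] using hε _⟩
      exact (hp n).trans ((Nat.le_add_right _ _).trans (Nat.le_add_right _ _))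
    · have hev : ∀ᶠ n in atTop, n ∈ x j → n ∈ x i := by
        rcases hij.lt_or_eq with h | rfl
        · exact htower i j h
        · simp
      obtain ⟨N, hN⟩ := eventually_atTop.1 hev
      filter_upwards [eventually_ge_atTop N] with n hn
      obtain ⟨k, hk, hkle⟩ := exists_abs_ternaryReal_sub_le (s := x j) (p := p n) (q := h (p n))
        fun m hm hpm => hgap n m (hN m (hn.trans ((hp n).trans hpm)) hm) hpm
      refine ⟨p n + k, (hp n).trans (Nat.le_add_right _ _), by omega, ?_⟩
      rw [if_pos (by omega), Nat.add_sub_cancel_left]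
      exact hkle.trans_lt (hh (p n) _ (Finset.mem_range.2 (by omega)))
  · have hcount' : (range x).Countable := by
      refine countable_of_injective_of_countable_image (f := ternaryReal)
        ternaryReal_injective.injOn ?_
      rwa [← range_comp]
    obtain ⟨i₀, -⟩ := gap id
    obtain ⟨y, hy⟩ := hcount'.exists_eq_range ⟨_, mem_range_self i₀⟩
    have hnext : ∀ j n : ℕ, ∃ a ∈ y j, n ≤ a := fun j n => by
      obtain ⟨i, hi⟩ : y j ∈ range x := hy ▸ mem_range_self j
      obtain ⟨a, ha, hna⟩ := (hinf i).exists_gt n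
      exact ⟨a, hi ▸ ha, hna.le⟩
    choose next hmem hle using hnext
    -- This function diagonalizes against the enumeration: `y j` has no such gap at any `p ≥ j`.
    obtain ⟨i, hi⟩ := gap fun p => (Finset.range (p + 1)).sup (fun j => next j p) + 1
    obtain ⟨j, hj⟩ : x i ∈ range y := hy ▸ mem_range_self i
    obtain ⟨p, hjp, hp⟩ := hi j
    have h1 := hp (next j p) (hj ▸ hmem j p) (hle j p)
    exact (Nat.lt_of_succ_le h1).not_ge
      (Finset.le_sup (f := fun j => next j p) (Finset.mem_range_succ_iff.2 hjp))

theorem IsStrongMeasureZeroSet.isMeagerAdditive_range_of_bounded {ι : Type*} {X : Set ℝ}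
    (hX : IsStrongMeasureZeroSet X)
    (hb : ∀ F : ι → ℕ → ℕ, ∃ h : ℕ → ℕ, ∀ i, ∀ᶠ n in atTop, F i n ≤ h n) (f : ι → X) :
    IsMeagerAdditive (range fun i => (f i : ℝ)) := by
  refine isMeagerAdditive_of_forall_exists_capture fun ε hε => ?_
  obtain ⟨u, hu⟩ := hX.exists_frequently_near hε
  choose k hk hku using fun i => hu (f i) (f i).2
  obtain ⟨h, hh⟩ := hb k
  refine ⟨fun _ => u, fun n => h n + 1, ?_⟩
  rintro _ ⟨i, rfl⟩
  filter_upwards [hh i] with n hn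
  exact ⟨k i n, hk i n, Nat.lt_succ_of_le hn, hku i n⟩

theorem mainTheorem3 :
    (∀ X : Set ℝ, IsStrongMeasureZeroSet X → X.Countable) ↔
      (∀ X : Set ℝ, IsMeagerAdditive X → X.Countable) := by
  refine ⟨fun h X hX => h X hX.isStrongMeasureZeroSet, fun h X hX => ?_⟩
  by_contra hXc
  let ι : Type := (Cardinal.aleph 1).ord.ToType
  have hcard : Cardinal.mk ι = Cardinal.aleph 1 := Cardinal.mk_ord_toType _
  have hι : ∀ i : ι, (Iio i).Countable := fun i => by
    have hlt := Cardinal.mk_Iio_lt i (by rw [hcard, Ordinal.type_toType])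
    rwa [hcard, Cardinal.lt_aleph_one_iff, Cardinal.le_aleph0_iff_set_countable] at hlt
  by_cases hb : ∀ F : ι → ℕ → ℕ, ∃ h : ℕ → ℕ, ∀ i, ∀ᶠ n in atTop, F i n ≤ h n
  · have hle : Cardinal.mk ι ≤ Cardinal.mk X := by
      rwa [hcard, Cardinal.aleph_one_le_iff, ← not_le, Cardinal.le_aleph0_iff_set_countable]
    obtain ⟨f⟩ := hle
    have hcount := h _ (hX.isMeagerAdditive_range_of_bounded hb f)
    have : Countable ι := by
      rw [← countable_univ_iff]
      refine countable_of_injective_of_countable_image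
        (Subtype.val_injective.comp f.injective).injOn ?_
      rwa [image_univ]
    have hlt := Cardinal.mk_le_aleph0 (α := ι)
    rw [hcard] at hlt
    exact hlt.not_gt Cardinal.aleph0_lt_aleph_one
  · push Not at hb
    obtain ⟨F, hF⟩ := hb
    obtain ⟨Y, hY, hYc⟩ := exists_uncountable_isMeagerAdditive_of_unbounded hι F
      fun g => by simpa using hF g
    exact hYc (h Y hY)
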